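/- Let $k$ be a field with a (possibly trivial) valuation $v\colon k\to\mathbb{R}\cup\{\infty\}$, let $H$ be a finitely generated abelian group with $\mathrm{rank}_{\mathbb{Z}}H\ge 1$, and let $I\subsetneq kH$ be a proper ideal of the group ring. Here a valuation on a commutative ring $A$ is a map $w\colon A\to\mathbb{R}\cup\{\infty\}$ with $w(ab)=w(a)+w(b)$, $w(a+b)\ge\min\{w(a),w(b)\}$, $w(0)=\infty$ and $w(1)=0$ (nonzero elements may have value $\infty$). Let $\kappa\colon kH\to kH/I$ be the quotient map and put $$\Delta^v_I(H)=\{\chi\in\mathrm{Hom}(H,\mathbb{R}) \mid \text{there is a valuation } w \text{ on } kH/I \text{ with } (w\circ\kappa)|_k=v \text{ and } (w\circ\kappa)|_H=\chi\}.$$ For an ideal $J\subseteq k\mathbb{Z}^N=k[x_1^{\pm1},\dots,x_N^{\pm1}]$, let $\mathrm{Trop}_{k,v}(J)\subseteq\mathbb{R}^N$ be the set of all $\mathbf{w}\in\mathbb{R}^N$ such that for every nonzero $f=\sum_{\mathbf{u}}a_{\mathbf{u}}x^{\mathbf{u}}\in J$ the minimum $\min\{v(a_{\mathbf{u}})+\mathbf{u}\cdot\mathbf{w}\mid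 a_{\mathbf{u}}\ne0\}$ is achieved at least twice. For $H$, choose an isomorphism $H\cong\mathbb{Z}^n\oplus\mathbb{Z}/d_1\oplus\cdots\oplus\mathbb{Z}/d_m$ with all $d_j\ge1$, and let $\psi\colon\mathbb{Z}^{n+m}\to H$ be the resulting epimorphism, $\psi^*\colon\mathrm{Hom}(H,\mathbb{R})\hookrightarrow\mathrm{Hom}(\mathbb{Z}^{n+m},\mathbb{R})=\mathbb{R}^{n+m}$ the induced embedding, and $\tilde I\subseteq k\mathbb{Z}^{n+m}$ the preimage of $I$ under the induced ring epimorphism $k\mathbb{Z}^{n+m}\to kH$. Define $$\mathrm{Trop}_{k,v}(I)=(\psi^*)^{-1}\bigl(\mathrm{Trop}_{k,v}(\tilde I)\bigr)\subseteq\mathrm{Hom}(H,\mathbb{R}).$$ Then, for every choice of such an isomorphism, $$\Delta^v_I(H)=\mathrm{Trop}_{k,v}(I).$$ -/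

import Mathlib

noncomputable section

namespace TropicalBieriGroves

/-- The characters `χ : H → ℝ` induced by valuations on `kH / I` extending `v`: there is a
valuation `w : kH / I → ℝ ∪ {∞}` which restricts to `v` along `k → kH → kH / I` and to `χ` along
`H → kH → kH / I`. The group `H` is written additively, so `h : H` is the monomial
`AddMonoidAlgebra.single h 1` of the group ring. -/
def bieriGrovesSet {k : Type*} [Field k] {H : Type*} [AddCommGroup H]
    (v : AddValuation k (WithTop ℝ)) (I : Ideal (AddMonoidAlgebra k H)) : Set (H →+ ℝ) :=
  {χ | ∃ w : AddValuation (AddMonoidAlgebra k H ⧸ I) (WithTop ℝ),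
    (∀ a : k, w (Ideal.Quotient.mk I (AddMonoidAlgebra.single 0 a)) = v a) ∧
    (∀ h : H, w (Ideal.Quotient.mk I (AddMonoidAlgebra.single h 1)) = ((χ h : ℝ) : WithTop ℝ))}

/-- Laurent polynomials over `k` in variables indexed by `ι`: the group ring of `ℤ^ι`. -/
abbrev Laurent (k : Type*) [Field k] (ι : Type*) : Type _ := AddMonoidAlgebra k (ι → ℤ)

/-- The quantity `v(a_u) + u ⋅ w` attached to the exponent `u` of `f = ∑ a_u x^u`. -/
def tropTerm {k : Type*} [Field k] {ι : Type*} [Fintype ι] (v : AddValuation k (WithTop ℝ))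
    (f : Laurent k ι) (w : ι → ℝ) (u : ι → ℤ) : WithTop ℝ :=
  v (f.coeff u) + ((∑ i, (u i : ℝ) * w i : ℝ) : WithTop ℝ)

/-- The tropical polynomial `trop(f)(w) = min {v(a_u) + u ⋅ w | a_u ≠ 0}`. -/
def tropPoly {k : Type*} [Field k] {ι : Type*} [Fintype ι] (v : AddValuation k (WithTop ℝ))
    (f : Laurent k ι) (w : ι → ℝ) : WithTop ℝ :=
  f.coeff.support.inf (tropTerm v f w)

/-- The tropical hypersurface of `f`: the points `w` at which the minimum defining `trop(f)(w)` is
achieved at least twice. -/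
def tropHypersurface {k : Type*} [Field k] {ι : Type*} [Fintype ι]
    (v : AddValuation k (WithTop ℝ)) (f : Laurent k ι) : Set (ι → ℝ) :=
  {w | ∃ u₁ ∈ f.coeff.support, ∃ u₂ ∈ f.coeff.support, u₁ ≠ u₂ ∧
    tropTerm v f w u₁ = tropPoly v f w ∧ tropTerm v f w u₂ = tropPoly v f w}

/-- The tropical variety of an ideal of Laurent polynomials: the intersection of the tropical
hypersurfaces of its nonzero elements. -/
def tropVarietyLaurent {k : Type*} [Field k] {ι : Type*} [Fintype ι]
    (v : AddValuation k (WithTop ℝ)) (J : Ideal (Laurent k ι)) : Set (ι → ℝ) :=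
  ⋂ f ∈ J, ⋂ (_ : f ≠ 0), tropHypersurface v f

/-- An isomorphism `H ≅ ℤ^n ⊕ ℤ/d_1 ⊕ ⋯ ⊕ ℤ/d_m` with all `d_j ≥ 1`. -/
structure CyclicDecomposition (H : Type*) [AddCommGroup H] where
  n : ℕ
  m : ℕ
  d : Fin m → ℕ
  d_pos : ∀ j, 0 < d j
  equiv : H ≃+ (Fin n → ℤ) × (∀ j : Fin m, ZMod (d j))

/-- Every finitely generated abelian group has such a decomposition. -/
theorem CyclicDecomposition.nonempty (H : Type*) [AddCommGroup H] [AddGroup.FG H] :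
    Nonempty (CyclicDecomposition H) := by
  classical
  obtain ⟨n, ι, _, p, hp, e, ⟨f⟩⟩ := AddCommGroup.equiv_free_prod_directSum_zmod H
  let σ := Fintype.equivFin ι
  refine ⟨⟨n, Fintype.card ι, fun j => p (σ.symm j) ^ e (σ.symm j),
    fun j => pow_pos (hp _).pos _, f.trans ?_⟩⟩
  refine AddEquiv.prodCongr (Finsupp.linearEquivFunOnFinite ℤ ℤ (Fin n)).toAddEquiv ?_
  exact (DirectSum.addEquivProd (fun i : ι => ZMod (p i ^ e i))).trans
    (LinearEquiv.piCongrLeft' ℤ (fun i : ι => ZMod (p i ^ e i)) σ).toAddEquiv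

namespace CyclicDecomposition

variable {H : Type*} [AddCommGroup H]

/-- The epimorphism `ψ : ℤ^(n+m) → H` given by a decomposition: reduce the `j`-th of the last `m`
coordinates modulo `d_j`. -/
def psi (D : CyclicDecomposition H) : (Fin D.n ⊕ Fin D.m → ℤ) →+ H where
  toFun u := D.equiv.symm (fun i => u (Sum.inl i), fun j => (u (Sum.inr j) : ZMod (D.d j)))
  map_zero' := by
    rw [← map_zero D.equiv.symm]
    congr 1
    ext <;> simp
  map_add' u u' := by
    rw [← map_add D.equiv.symm]
    congr 1
    ext <;> simp

/-- The embedding `ψ^* : Hom(H, ℝ) → Hom(ℤ^(n+m), ℝ) = ℝ^(n+m)`, a homomorphism on `ℤ^(n+m)` being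
identified with the vector of its values at the standard basis. -/
def psiStar (D : CyclicDecomposition H) (χ : H →+ ℝ) : Fin D.n ⊕ Fin D.m → ℝ :=
  fun i => χ (D.psi (Pi.single i 1))

end CyclicDecomposition

/-- The tropical variety of an ideal `I` of `kH`, computed with a decomposition of `H`: it is
`(ψ^*)⁻¹ Trop(Ĩ)`, where `Ĩ` is the preimage of `I` under the epimorphism `kℤ^(n+m) → kH` induced
by `ψ`, i.e. the ideal containing the kernel of it with `kℤ^(n+m) / Ĩ ≅ kH / I`. -/
def tropVariety {k : Type*} [Field k] {H : Type*} [AddCommGroup H] (D : CyclicDecomposition H)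
    (v : AddValuation k (WithTop ℝ)) (I : Ideal (AddMonoidAlgebra k H)) : Set (H →+ ℝ) :=
  {χ | D.psiStar χ ∈
    tropVarietyLaurent v (I.comap (AddMonoidAlgebra.mapDomainRingHom k D.psi))}

end TropicalBieriGroves

end

/-! If `w` is a valuation inducing `v` and `χ`, the terms of an element of `Ĩ` map to elements of
`kH / I` that sum to zero and have the tropical terms as values; a unique minimum would be the
finite value of the sum. Conversely, a tropical `χ` yields the Gauss norm `exp (-min (v a_h + χ h))`
on `kH` and its quotient seminorm on `kH / I`. The tropical condition says exactly what keeps the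
norm of `1` equal to `1` (`NoUniqueMin.le_zero_of_gaussGE`). A minimal nonarchimedean seminorm below
it exists by Zorn and is multiplicative (`map_mul_of_minimal`), so its `-log` is a valuation.
Passing to a smaller seminorm does not change values on monomials, since these are units
(`negLog_apply_single`). -/

noncomputable section

namespace TropicalBieriGroves

/-! ### Minimal nonarchimedean seminorms are multiplicative -/

section MultiplicativeSeminorm

variable {R : Type*} [CommRing R]

/-- Nonarchimedean submultiplicative seminorms with value one at one. -/
structure IsNonarchSeminorm (f : R → ℝ) : Prop where
  nonneg : ∀ x, 0 ≤ f x
  zero : f 0 = 0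
  one : f 1 = 1
  neg : ∀ x, f (-x) = f x
  add : IsNonarchimedean f
  mul : ∀ x y, f (x * y) ≤ f x * f y

namespace IsNonarchSeminorm

/-- The bundled seminorm. -/
def toRingSeminorm {f : R → ℝ} (hf : IsNonarchSeminorm f) : RingSeminorm R where
  toFun := f
  map_zero' := hf.zero
  add_le' x y := (hf.add x y).trans (max_le_add_of_nonneg (hf.nonneg x) (hf.nonneg y))
  neg' := hf.neg
  mul_le' := hf.mul

theorem of_ringSeminorm (p : RingSeminorm R) (h1 : p 1 = 1) (hna : IsNonarchimedean p) :
    IsNonarchSeminorm p :=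
  ⟨fun x => apply_nonneg p x, map_zero p, h1, fun x => map_neg_eq_map p x, hna,
    fun x y => map_mul_le_mul p x y⟩

/-- Two members of a chain have a common lower member, so the two-variable inequalities can be
checked on a single seminorm. -/
theorem iInf_of_chain {c : Set (R → ℝ)} (hc : ∀ f ∈ c, IsNonarchSeminorm f)
    (hchain : IsChain (· ≤ ·) c) (hne : c.Nonempty) :
    IsNonarchSeminorm (fun x => ⨅ f : c, f.1 x) := by
  have : Nonempty c := hne.to_subtype
  have bdd (x : R) : BddBelow (Set.range fun f : c => f.1 x) :=
    ⟨0, by rintro _ ⟨f, rfl⟩; exact (hc _ f.2).nonneg x⟩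
  have common (f g : c) : ∃ e : c, e.1 ≤ f.1 ∧ e.1 ≤ g.1 := by
    rcases hchain.total f.2 g.2 with h | h
    · exact ⟨f, le_rfl, h⟩
    · exact ⟨g, h, le_rfl⟩
  refine ⟨fun x => le_ciInf fun f => (hc _ f.2).nonneg x, ?_, ?_, ?_, ?_, ?_⟩
  · simp [fun f : c => (hc _ f.2).zero]
  · simp [fun f : c => (hc _ f.2).one]
  · intro x
    simp [fun f : c => (hc _ f.2).neg]
  · intro x y
    refine le_of_forall_gt fun t ht => ?_
    obtain ⟨f, hf⟩ := exists_lt_of_ciInf_lt (lt_of_le_of_lt (le_max_left _ _) ht)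
    obtain ⟨g, hg⟩ := exists_lt_of_ciInf_lt (lt_of_le_of_lt (le_max_right _ _) ht)
    obtain ⟨e, hef, heg⟩ := common f g
    exact (ciInf_le (bdd _) e).trans_lt
      (((hc _ e.2).add x y).trans_lt (max_lt ((hef x).trans_lt hf) ((heg y).trans_lt hg)))
  · intro x y
    refine le_mul_of_forall_lt₀ fun s hs t ht => ?_
    obtain ⟨f, hf⟩ := exists_lt_of_ciInf_lt hs
    obtain ⟨g, hg⟩ := exists_lt_of_ciInf_lt ht
    obtain ⟨e, hef, heg⟩ := common f g
    have he := hc _ e.2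
    exact (ciInf_le (bdd _) e).trans ((he.mul x y).trans
      (mul_le_mul ((hef x).trans hf.le) ((heg y).trans hg.le) (he.nonneg y)
        ((he.nonneg x).trans ((hef x).trans hf.le))))

/-- The smoothing `lim f (x ^ n) ^ (1 / n)` is again such a seminorm and lies below `f`, so
minimality forces equality. -/
theorem isPowMul_of_minimal {f : R → ℝ} (hf : Minimal IsNonarchSeminorm f) : IsPowMul f := by
  let p := hf.prop.toRingSeminorm
  have h1 : p 1 ≤ 1 := hf.prop.one.le
  have hpow : IsPowMul (smoothingFun p) := isPowMul_smoothingFun p h1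
  have hone : smoothingSeminorm p h1 hf.prop.add 1 = 1 :=
    (smoothingFun_of_powMul p h1 fun n _ => by
      rw [one_pow]
      change f 1 = f 1 ^ n
      rw [hf.prop.one, one_pow]).trans hf.prop.one
  have hs : IsNonarchSeminorm (smoothingFun p) :=
    of_ringSeminorm (smoothingSeminorm p h1 hf.prop.add) hone
      (isNonarchimedean_smoothingFun p h1 hf.prop.add)
  have heq : smoothingFun p = f :=
    le_antisymm (smoothingFun_le_self p) (hf.le_of_le hs (smoothingFun_le_self p))
  exact heq ▸ hpow

/-- For `f x ≠ 0`, the seminorm `y ↦ lim f (y * x ^ n) / f x ^ n` lies below `f` and is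
multiplicative with respect to `x`; by minimality it is `f`. -/
theorem map_mul_of_minimal {f : R → ℝ} (hf : Minimal IsNonarchSeminorm f) (x y : R) :
    f (x * y) = f x * f y := by
  by_cases hx : f x = 0
  · refine le_antisymm (hf.prop.mul x y) ?_
    rw [hx, zero_mul]
    exact hf.prop.nonneg _
  let p := hf.prop.toRingSeminorm
  have h1 : p 1 ≤ 1 := hf.prop.one.le
  have hpm : IsPowMul p := isPowMul_of_minimal hf
  have hx' : p x ≠ 0 := hx
  have hs : IsNonarchSeminorm (seminormFromConst' x p) :=
    of_ringSeminorm (seminormFromConst h1 hx' hpm) (seminormFromConst_one h1 hx' hpm)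
      (seminormFromConst_isNonarchimedean h1 hx' hpm hf.prop.add)
  have hle : seminormFromConst' x p ≤ f := seminormFromConst_le_seminorm h1 hx' hpm
  have heq : seminormFromConst' x p = f := le_antisymm hle (hf.le_of_le hs hle)
  simpa only [heq] using seminormFromConst_const_mul h1 hx' hpm y

/-- Every nonarchimedean seminorm dominates a multiplicative one. -/
theorem exists_multiplicative_le {q : R → ℝ} (hq : IsNonarchSeminorm q) :
    ∃ f ≤ q, IsNonarchSeminorm f ∧ ∀ x y, f (x * y) = f x * f y := by
  -- The order dual turns the maximal element of Zorn's lemma into a minimal one.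
  obtain ⟨f, hfq, hf⟩ := zorn_le_nonempty₀ (α := (R → ℝ)ᵒᵈ) {f | IsNonarchSeminorm f}
    (fun c hc hchain y hy => ⟨_, iInf_of_chain hc hchain.symm ⟨y, hy⟩, fun f hf x =>
      ciInf_le (f := fun g : c => g.1 x)
        ⟨0, by rintro _ ⟨g, rfl⟩; exact (hc g.2).nonneg x⟩ ⟨f, hf⟩⟩) q hq
  exact ⟨f, hfq, hf.prop, map_mul_of_minimal (f := f) ⟨hf.prop, fun g hg h => hf.2 hg h⟩⟩

end IsNonarchSeminorm

/-- The order-reversing map `r ↦ -log r` from the nonnegative reals to `ℝ ∪ {∞}`. -/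
def negLog (r : ℝ) : WithTop ℝ := if r = 0 then ⊤ else ((-Real.log r : ℝ) : WithTop ℝ)

theorem negLog_exp (t : ℝ) : negLog (Real.exp (-t)) = t := by
  simp [negLog, Real.exp_ne_zero]

theorem negLog_mul (r s : ℝ) : negLog (r * s) = negLog r + negLog s := by
  by_cases hr : r = 0
  · simp [negLog, hr]
  by_cases hs : s = 0
  · simp [negLog, hs]
  simp only [negLog, hr, hs, mul_eq_zero, or_self, if_false, Real.log_mul hr hs]
  rw [← WithTop.coe_add, neg_add]

theorem negLog_anti {r s : ℝ} (hr : 0 ≤ r) (h : r ≤ s) : negLog s ≤ negLog r := by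
  rcases hr.eq_or_lt with rfl | hr
  · simp [negLog]
  simp only [negLog, hr.ne', (hr.trans_le h).ne', if_false]
  exact WithTop.coe_le_coe.2 (neg_le_neg (Real.log_le_log hr h))

/-- The valuation `-log f` of a multiplicative nonarchimedean seminorm `f`. -/
def IsNonarchSeminorm.toAddValuation {f : R → ℝ} (hf : IsNonarchSeminorm f)
    (hmul : ∀ x y, f (x * y) = f x * f y) : AddValuation R (WithTop ℝ) :=
  AddValuation.of (fun x => negLog (f x)) (by simp [negLog, hf.zero]) (by simp [negLog, hf.one])
    (fun x y => by
      refine le_trans ?_ (negLog_anti (hf.nonneg _) (hf.add x y))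
      rcases max_choice (f x) (f y) with h | h <;> rw [h]
      exacts [min_le_left _ _, min_le_right _ _])
    (fun x y => by rw [hmul, negLog_mul])

end MultiplicativeSeminorm

/-! ### The Gauss seminorm on the quotient and its values on monomials -/

section GaussSeminorm

variable {k : Type*} [Field k] {H : Type*} [AddCommGroup H]

/-- The Gauss valuation `min (v (a_h) + χ h)` of `f = ∑ a_h h` is at least `t`. -/
def GaussGE (v : AddValuation k (WithTop ℝ)) (χ : H →+ ℝ) (t : ℝ) (f : AddMonoidAlgebra k H) :
    Prop :=
  ∀ h, ((t - χ h : ℝ) : WithTop ℝ) ≤ v (f.coeff h)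

namespace GaussGE

variable {v : AddValuation k (WithTop ℝ)} {χ : H →+ ℝ} {s t : ℝ} {f g : AddMonoidAlgebra k H}

theorem mono (hf : GaussGE v χ t f) (h : s ≤ t) : GaussGE v χ s f := fun i =>
  (WithTop.coe_le_coe.2 (by linarith)).trans (hf i)

theorem neg (hf : GaussGE v χ t f) : GaussGE v χ t (-f) := fun i => by
  simpa [AddMonoidAlgebra.coeff_neg] using hf i

theorem add (hf : GaussGE v χ t f) (hg : GaussGE v χ t g) : GaussGE v χ t (f + g) := fun i => by
  rw [AddMonoidAlgebra.coeff_add, Finsupp.add_apply]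
  exact v.map_le_add (hf i) (hg i)

theorem mul (hf : GaussGE v χ s f) (hg : GaussGE v χ t g) : GaussGE v χ (s + t) (f * g) := by
  classical
  intro i
  rw [AddMonoidAlgebra.coeff_mul]
  refine v.map_le_sum fun a _ => v.map_le_sum fun b _ => ?_
  dsimp only
  split_ifs with hab
  · rw [v.map_mul, ← hab]
    refine le_trans (le_of_eq ?_) (add_le_add (hf a) (hg b))
    rw [← WithTop.coe_add, map_add]
    congr 1
    ring
  · simp

theorem single {c : k} {h : H} (hc : ((t - χ h : ℝ) : WithTop ℝ) ≤ v c) :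
    GaussGE v χ t (AddMonoidAlgebra.single h c) := by
  classical
  intro i
  rw [AddMonoidAlgebra.coeff_single, Finsupp.single_apply]
  split_ifs with hi
  · rwa [← hi]
  · simp

variable (v χ) in
theorem exists_of (f : AddMonoidAlgebra k H) : ∃ t, GaussGE v χ t f := by
  induction f using AddMonoidAlgebra.induction_linear with
  | zero => exact ⟨0, fun i => by simp⟩
  | add f g hf hg =>
    obtain ⟨s, hs⟩ := hf
    obtain ⟨t, ht⟩ := hg
    exact ⟨min s t, (hs.mono (min_le_left _ _)).add (ht.mono (min_le_right _ _))⟩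
  | single h c =>
    cases hc : v c with
    | top => exact ⟨0, single (by simp [hc])⟩
    | coe r => exact ⟨r + χ h, single (by simp [hc])⟩

end GaussGE

variable (v : AddValuation k (WithTop ℝ)) (χ : H →+ ℝ) (I : Ideal (AddMonoidAlgebra k H))

/-- The norms `exp (-t)` for the lower bounds `t` of the Gauss valuations of the lifts of `a`. -/
def gaussBounds (a : AddMonoidAlgebra k H ⧸ I) : Set ℝ :=
  {r | ∃ t f, GaussGE v χ t f ∧ Ideal.Quotient.mk I f = a ∧ Real.exp (-t) = r}

/-- The quotient seminorm on `kH / I` of the Gauss norm on `kH`. -/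
def gaussSeminorm (a : AddMonoidAlgebra k H ⧸ I) : ℝ := sInf (gaussBounds v χ I a)

variable {v χ I}

theorem gaussBounds_nonempty (a : AddMonoidAlgebra k H ⧸ I) : (gaussBounds v χ I a).Nonempty := by
  obtain ⟨f, rfl⟩ := Ideal.Quotient.mk_surjective a
  obtain ⟨t, ht⟩ := GaussGE.exists_of v χ f
  exact ⟨_, t, f, ht, rfl, rfl⟩

theorem gaussBounds_bddBelow (a : AddMonoidAlgebra k H ⧸ I) : BddBelow (gaussBounds v χ I a) :=
  ⟨0, by rintro _ ⟨t, f, -, -, rfl⟩; positivity⟩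

theorem gaussSeminorm_nonneg (a : AddMonoidAlgebra k H ⧸ I) : 0 ≤ gaussSeminorm v χ I a :=
  Real.sInf_nonneg (by rintro _ ⟨t, f, -, -, rfl⟩; positivity)

theorem GaussGE.gaussSeminorm_le {t : ℝ} {f : AddMonoidAlgebra k H} (hf : GaussGE v χ t f) :
    gaussSeminorm v χ I (Ideal.Quotient.mk I f) ≤ Real.exp (-t) :=
  csInf_le (gaussBounds_bddBelow _) ⟨t, f, hf, rfl, rfl⟩

theorem exists_gaussGE_of_gaussSeminorm_lt {a : AddMonoidAlgebra k H ⧸ I} {r : ℝ}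
    (h : gaussSeminorm v χ I a < r) :
    ∃ t f, GaussGE v χ t f ∧ Ideal.Quotient.mk I f = a ∧ Real.exp (-t) < r := by
  obtain ⟨_, ⟨t, f, hf, ha, rfl⟩, hr⟩ := exists_lt_of_csInf_lt (gaussBounds_nonempty a) h
  exact ⟨t, f, hf, ha, hr⟩

theorem gaussSeminorm_neg_le (a : AddMonoidAlgebra k H ⧸ I) :
    gaussSeminorm v χ I (-a) ≤ gaussSeminorm v χ I a := by
  refine le_of_forall_gt fun r hr => ?_
  obtain ⟨t, f, hf, rfl, ht⟩ := exists_gaussGE_of_gaussSeminorm_lt hr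
  rw [← map_neg]
  exact hf.neg.gaussSeminorm_le.trans_lt ht

variable (v χ I) in
/-- No element of `I` has a term whose value is smaller than that of every other term. -/
def NoUniqueMin : Prop :=
  ∀ f ∈ I, ∀ h, f.coeff h ≠ 0 →
    ∃ h' ≠ h, v (f.coeff h') + (χ h' : ℝ) ≤ v (f.coeff h) + (χ h : ℝ)

/-- If `t > 0`, the constant term of `1 - f ∈ I` has value `0` while every other term has value at
least `t`: a forbidden unique minimum. -/
theorem NoUniqueMin.le_zero_of_gaussGE (hI : NoUniqueMin v χ I) {t : ℝ}
    {f : AddMonoidAlgebra k H} (hf : GaussGE v χ t f) (h1 : Ideal.Quotient.mk I f = 1) :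
    t ≤ 0 := by
  by_contra! ht
  have hmem : 1 - f ∈ I := by
    rw [← Ideal.Quotient.eq_zero_iff_mem, map_sub, h1, map_one, sub_self]
  have h0 : v ((1 - f).coeff 0) = 0 := by
    have hlt : v 1 < v (f.coeff 0) := by
      refine lt_of_lt_of_le ?_ (hf 0)
      simpa using ht
    rw [AddMonoidAlgebra.coeff_sub, Finsupp.sub_apply, AddMonoidAlgebra.one_def,
      AddMonoidAlgebra.coeff_single, Finsupp.single_eq_same, v.map_sub_eq_of_lt_left hlt, v.map_one]
  obtain ⟨h, hne, hle⟩ := hI _ hmem 0 (fun h => by rw [h, v.map_zero] at h0; exact WithTop.top_ne_zero h0)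
  have hc : (1 - f).coeff h = -f.coeff h := by
    simp [AddMonoidAlgebra.coeff_sub, AddMonoidAlgebra.one_def, Finsupp.single_eq_of_ne hne]
  rw [h0, hc, v.map_neg, map_zero] at hle
  have := (add_le_add_left (hf h) ((χ h : ℝ) : WithTop ℝ)).trans hle
  rw [← WithTop.coe_add] at this
  have := WithTop.coe_le_coe.1 (this.trans_eq (by simp : _ = ((0 : ℝ) : WithTop ℝ)))
  linarith

theorem NoUniqueMin.isNonarchSeminorm (hI : NoUniqueMin v χ I) :
    IsNonarchSeminorm (gaussSeminorm v χ I) where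
  nonneg := gaussSeminorm_nonneg
  zero := by
    refine le_antisymm (le_of_forall_gt fun r hr => ?_) (gaussSeminorm_nonneg _)
    -- Every `t` bounds the zero polynomial; this one gives norm bound `r / 2 < r`.
    have h0 : GaussGE v χ (-Real.log (r / 2)) 0 := fun i => by simp
    rw [← map_zero (Ideal.Quotient.mk I)]
    refine h0.gaussSeminorm_le.trans_lt ?_
    rw [neg_neg, Real.exp_log (by linarith)]
    linarith
  one := by
    refine le_antisymm ?_ ?_
    · have h1 : GaussGE v χ 0 1 := GaussGE.single (by simp)
      simpa using h1.gaussSeminorm_le (I := I)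
    · refine le_csInf (gaussBounds_nonempty _) ?_
      rintro _ ⟨t, f, hf, h1, rfl⟩
      exact Real.one_le_exp (neg_nonneg.2 (hI.le_zero_of_gaussGE hf h1))
  neg a := le_antisymm (gaussSeminorm_neg_le a) (by simpa using gaussSeminorm_neg_le (-a))
  add a b := by
    refine le_of_forall_gt fun r hr => ?_
    obtain ⟨s, f, hf, rfl, hs⟩ :=
      exists_gaussGE_of_gaussSeminorm_lt (lt_of_le_of_lt (le_max_left _ _) hr)
    obtain ⟨t, g, hg, rfl, ht⟩ :=
      exists_gaussGE_of_gaussSeminorm_lt (lt_of_le_of_lt (le_max_right _ _) hr)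
    rw [← map_add]
    refine ((hf.mono (min_le_left s t)).add (hg.mono (min_le_right s t))).gaussSeminorm_le.trans_lt
      ?_
    rcases min_choice s t with h | h <;> rwa [h]
  mul a b := by
    refine le_mul_of_forall_lt₀ fun r hr r' hr' => ?_
    obtain ⟨s, f, hf, rfl, hs⟩ := exists_gaussGE_of_gaussSeminorm_lt hr
    obtain ⟨t, g, hg, rfl, ht⟩ := exists_gaussGE_of_gaussSeminorm_lt hr'
    rw [← map_mul]
    refine (hf.mul hg).gaussSeminorm_le.trans ?_
    rw [neg_add, Real.exp_add]
    exact mul_le_mul hs.le ht.le (Real.exp_pos _).le ((Real.exp_pos _).le.trans hs.le)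

/-- The Gauss norm bounds `f` from above at the monomial and at its inverse. The two bounds multiply
to `1`, as do the two values of `f`, so both bounds are attained. -/
theorem negLog_apply_single {f : AddMonoidAlgebra k H ⧸ I → ℝ} (hf : IsNonarchSeminorm f)
    (hmul : ∀ x y, f (x * y) = f x * f y) (hle : f ≤ gaussSeminorm v χ I) (h : H) (c : k) :
    negLog (f (Ideal.Quotient.mk I (AddMonoidAlgebra.single h c))) = v c + (χ h : ℝ) := by
  by_cases hc : c = 0
  · simp [hc, negLog, hf.zero]
  obtain ⟨r, hr⟩ := WithTop.ne_top_iff_exists.1 ((v.ne_top_iff).2 hc)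
  have hinv : v c⁻¹ = ((-r : ℝ) : WithTop ℝ) := by
    have hne : v c⁻¹ ≠ ⊤ := (v.ne_top_iff).2 (inv_ne_zero hc)
    obtain ⟨s, hs⟩ := WithTop.ne_top_iff_exists.1 hne
    have hrs : v c + v c⁻¹ = 0 := by rw [← v.map_mul, mul_inv_cancel₀ hc, v.map_one]
    rw [← hr, ← hs, ← WithTop.coe_add] at hrs
    have : r + s = 0 := by exact_mod_cast hrs
    rw [← hs, ← eq_neg_of_add_eq_zero_right this]
  set x := Ideal.Quotient.mk I (AddMonoidAlgebra.single h c)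
  set y := Ideal.Quotient.mk I (AddMonoidAlgebra.single (-h) c⁻¹)
  have hx : f x ≤ Real.exp (-(r + χ h)) := (hle x).trans
    (GaussGE.gaussSeminorm_le (GaussGE.single (by rw [← hr, add_sub_cancel_right])))
  have hy : f y ≤ Real.exp (-(-(r + χ h))) := (hle y).trans
    (GaussGE.gaussSeminorm_le (GaussGE.single
      (by rw [hinv, map_neg]; exact WithTop.coe_le_coe.2 (by linarith))))
  have hxy : f x * f y = 1 := by
    rw [← hmul, ← map_mul, AddMonoidAlgebra.single_mul_single, add_neg_cancel, mul_inv_cancel₀ hc,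
      ← AddMonoidAlgebra.one_def, map_one, hf.one]
  have hfx : f x = Real.exp (-(r + χ h)) := by
    refine le_antisymm hx ?_
    have h1 : 1 ≤ f x * Real.exp (-(-(r + χ h))) :=
      hxy.symm.le.trans (mul_le_mul_of_nonneg_left hy (hf.nonneg x))
    rw [Real.exp_neg (-(r + χ h)), ← div_eq_mul_inv, one_le_div (Real.exp_pos _)] at h1
    exact h1
  rw [hfx, negLog_exp, ← hr, WithTop.coe_add]

theorem NoUniqueMin.mem_bieriGrovesSet (hI : NoUniqueMin v χ I) : χ ∈ bieriGrovesSet v I := by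
  obtain ⟨f, hle, hf, hmul⟩ := hI.isNonarchSeminorm.exists_multiplicative_le
  refine ⟨hf.toAddValuation hmul, fun a => ?_, fun h => ?_⟩
  · exact (negLog_apply_single hf hmul hle 0 a).trans (by simp)
  · exact (negLog_apply_single hf hmul hle h 1).trans (by simp)

end GaussSeminorm

/-! ### Comparison with the tropical variety of the lifted ideal -/

section Tropical

variable {k : Type*} [Field k] {H : Type*} [AddCommGroup H] (D : CyclicDecomposition H)

theorem CyclicDecomposition.psi_surjective : Function.Surjective D.psi := by
  intro h
  choose z hz using fun j => ZMod.intCast_surjective ((D.equiv h).2 j)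
  refine ⟨Sum.elim (D.equiv h).1 z, ?_⟩
  rw [← D.equiv.symm_apply_apply h]
  change D.equiv.symm _ = _
  congr 1
  ext <;> simp [hz]

theorem CyclicDecomposition.sum_mul_psiStar (χ : H →+ ℝ) (u : Fin D.n ⊕ Fin D.m → ℤ) :
    ∑ i, (u i : ℝ) * D.psiStar χ i = χ (D.psi u) := by
  conv_rhs => rw [← Finset.univ_sum_single u, map_sum, map_sum]
  refine Finset.sum_congr rfl fun i _ => ?_
  have : (Pi.single i (u i) : Fin D.n ⊕ Fin D.m → ℤ) = u i • Pi.single i 1 := by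
    rw [← Pi.single_smul]
    simp
  rw [this, map_zsmul, map_zsmul, zsmul_eq_mul, CyclicDecomposition.psiStar]

theorem tropTerm_psiStar (v : AddValuation k (WithTop ℝ)) (χ : H →+ ℝ)
    (f : Laurent k (Fin D.n ⊕ Fin D.m)) (u : Fin D.n ⊕ Fin D.m → ℤ) :
    tropTerm v f (D.psiStar χ) u = v (f.coeff u) + (χ (D.psi u) : ℝ) := by
  rw [tropTerm, D.sum_mul_psiStar]

variable {D} {v : AddValuation k (WithTop ℝ)} {χ : H →+ ℝ} {I : Ideal (AddMonoidAlgebra k H)}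

/-- Lifting `f` along a set-theoretic section of `ψ` puts one exponent over each element of `H`, so
distinct minimizing exponents of the lift stay distinct in `H`. -/
theorem noUniqueMin_of_mem_tropVariety (hχ : χ ∈ tropVariety D v I) : NoUniqueMin v χ I := by
  intro f hf h hh
  obtain ⟨s, hs⟩ := D.psi_surjective.hasRightInverse
  have hsinj : Function.Injective s := hs.injective
  set g : Laurent k (Fin D.n ⊕ Fin D.m) := AddMonoidAlgebra.mapDomain s f with hg
  have hgs (i : H) : g.coeff (s i) = f.coeff i := Finsupp.mapDomain_apply hsinj _ _
  have hgf : AddMonoidAlgebra.mapDomainRingHom k D.psi g = f := by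
    ext i
    change Finsupp.mapDomain D.psi (Finsupp.mapDomain s f.coeff) i = _
    rw [← Finsupp.mapDomain_comp, hs.comp_eq_id, Finsupp.mapDomain_id]
  have hgsupp {u} (hu : u ∈ g.coeff.support) : ∃ i, s i = u := by
    classical
    obtain ⟨i, -, hi⟩ := Finset.mem_image.1 (Finsupp.mapDomain_support hu)
    exact ⟨i, hi⟩
  have hsh : s h ∈ g.coeff.support := by rwa [Finsupp.mem_support_iff, hgs]
  have hg0 : g ≠ 0 := by
    intro h0
    rw [h0] at hsh
    simp at hsh
  have hmem : g ∈ I.comap (AddMonoidAlgebra.mapDomainRingHom k D.psi) := by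
    rwa [Ideal.mem_comap, hgf]
  obtain ⟨u₁, hu₁, u₂, hu₂, hne, h₁, h₂⟩ :=
    Set.mem_iInter.1 (Set.mem_iInter₂.1 hχ g hmem) hg0
  have key {u} (hu : u ∈ g.coeff.support) (hmin : tropTerm v g (D.psiStar χ) u =
      tropPoly v g (D.psiStar χ)) (hus : u ≠ s h) :
      ∃ h' ≠ h, v (f.coeff h') + (χ h' : ℝ) ≤ v (f.coeff h) + (χ h : ℝ) := by
    obtain ⟨i, rfl⟩ := hgsupp hu
    refine ⟨i, fun hi => hus (congrArg s hi), ?_⟩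
    have hle : tropTerm v g (D.psiStar χ) (s i) ≤ tropTerm v g (D.psiStar χ) (s h) :=
      hmin.trans_le (Finset.inf_le hsh)
    simpa only [tropTerm_psiStar, hgs, hs i, hs h] using hle
  -- At least one of the two minimizers differs from `s h`.
  by_cases hu : u₁ = s h
  · exact key hu₂ h₂ fun h' => hne (hu.trans h'.symm)
  · exact key hu₁ h₁ hu

theorem mem_tropVariety_of_mem_bieriGrovesSet (hχ : χ ∈ bieriGrovesSet v I) :
    χ ∈ tropVariety D v I := by
  classical
  obtain ⟨w, hwv, hwχ⟩ := hχ
  refine Set.mem_iInter₂.2 fun f hf => Set.mem_iInter.2 fun hf0 => ?_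
  let F (u : Fin D.n ⊕ Fin D.m → ℤ) : AddMonoidAlgebra k H ⧸ I :=
    Ideal.Quotient.mk I (AddMonoidAlgebra.single (D.psi u) (f.coeff u))
  have hF (u) : w (F u) = tropTerm v f (D.psiStar χ) u := by
    rw [tropTerm_psiStar, ← hwv, ← hwχ, ← w.map_mul, ← map_mul,
      AddMonoidAlgebra.single_mul_single, zero_add, mul_one]
  have hsum : ∑ u ∈ f.coeff.support, F u = 0 := by
    rw [← map_sum, Ideal.Quotient.eq_zero_iff_mem]
    convert Ideal.mem_comap.1 hf using 1
    conv_rhs => rw [← AddMonoidAlgebra.sum_coeff_single f, Finsupp.sum, map_sum]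
    simp
  have hne : f.coeff.support.Nonempty := by
    rwa [Finsupp.support_nonempty_iff, ne_eq, AddMonoidAlgebra.coeff_eq_zero]
  obtain ⟨u₁, hu₁, h₁⟩ := Finset.exists_mem_eq_inf _ hne (tropTerm v f (D.psiStar χ))
  refine ⟨u₁, hu₁, ?_⟩
  by_contra! hcon
  have hlt : ∀ u ∈ f.coeff.support \ {u₁}, w (F u₁) < w (F u) := by
    intro u hu
    rw [Finset.mem_sdiff, Finset.mem_singleton] at hu
    rw [hF, hF, ← h₁]
    exact lt_of_le_of_ne (Finset.inf_le hu.1) fun h =>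
      hcon u hu.1 (Ne.symm hu.2) h₁.symm h.symm
  -- On the field `k`, only `0` has value `⊤`, so the minimal term is finite although `w` may be `⊤`
  -- at nonzero elements.
  have htop : w (F u₁) ≠ ⊤ := by
    rw [hF, tropTerm]
    exact WithTop.add_ne_top.2
      ⟨(v.ne_top_iff).2 (Finsupp.mem_support_iff.1 hu₁), WithTop.coe_ne_top⟩
  have hval : w (∑ u ∈ f.coeff.support, F u) = w (F u₁) :=
    Valuation.map_sum_eq_of_lt w.toValuation hu₁ hlt
  exact htop (by rw [← hval, hsum, w.map_zero])

end Tropical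

end TropicalBieriGroves

end

theorem mainTheorem11 {k : Type*} [Field k] {H : Type*} [AddCommGroup H] [AddGroup.FG H]
    (hH : 1 ≤ Module.finrank ℤ H) (v : AddValuation k (WithTop ℝ))
    (I : Ideal (AddMonoidAlgebra k H)) (hI : I ≠ ⊤) :
    ∀ D : TropicalBieriGroves.CyclicDecomposition H,
      TropicalBieriGroves.bieriGrovesSet v I = TropicalBieriGroves.tropVariety D v I := by
  intro D
  ext χ
  exact ⟨TropicalBieriGroves.mem_tropVariety_of_mem_bieriGrovesSet,
    fun h => (TropicalBieriGroves.noUniqueMin_of_mem_tropVariety h).mem_bieriGrovesSet⟩
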